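/- Let $U=\begin{bmatrix}a&b\\c&d\end{bmatrix}$ be a complex unitary matrix with $abcd\neq0$, let $\kappa_2,w_0\in\mathbb R$, put $w_t=\kappa_2t+w_0$ for $t=0,1,2,\dots$, and let $\alpha,\beta\in\mathbb C$ with $|\alpha|^2+|\beta|^2=1$. Consider the time-dependent quantum walk on $\mathbb Z$ with coins $$U_t=\begin{bmatrix}a&b\,e^{iw_t}\\c\,e^{-iw_t}&d\end{bmatrix},$$ that is, the amplitudes $\psi_t(x)\in\mathbb C^2$ given by $\psi_0(0)={}^T[\alpha,\beta]$, $\psi_0(x)=0$ for $x\ne0$, and $$\psi_{t+1}(x)=\begin{bmatrix}a&b\,e^{iw_t}\\0&0\end{bmatrix}\psi_t(x+1)+\begin{bmatrix}0&0\\c\,e^{-iw_t}&d\end{bmatrix}\psi_t(x-1),$$ and let $X_t$ be the position of the walker at time $t$, so that $P(X_t=x)=\|\psi_t(x)\|^2$ for $x\in\mathbb Z$. Write $R(k)=\begin{bmatrix}e^{ik}&0\\0&e^{-ik}\end{bmatrix}$. Then: (1) $U_t=R(w_t/2)\,U\,R(-w_t/2)$ for every $t$, and for all $t$ and $x$ the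 probability $P(X_t=x)$ is the same as for the usual walk, whose coin is $U$ at all times, started at the origin in the state $R(-w_0/2)\,{}^T[\alpha,\beta]$. (2) As $t\to\infty$, $X_t/t$ converges in distribution to a random variable with the probability density $$f_2(x)=f_K(x;a)\left\{1-\left(|\alpha|^2-|\beta|^2+\frac{a\alpha\,\overline{b\beta}\,e^{-iw_0}+\overline{a\alpha}\,b\beta\,e^{iw_0}}{|a|^2}\right)x\right\},$$ where $$f_K(x;a)=\frac{\sqrt{1-|a|^2}}{\pi(1-x^2)\sqrt{|a|^2-x^2}}\quad\text{for }|x|<|a|,\qquad f_K(x;a)=0\quad\text{otherwise}.$$ -/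

import Mathlib

open MeasureTheory ProbabilityTheory Filter Topology Matrix

noncomputable section

namespace QuantumWalk

/-- The upper half `P` of a coin matrix `U`: first row of `U`, second row zero. -/
def upperPart (U : Matrix (Fin 2) (Fin 2) ℂ) : Matrix (Fin 2) (Fin 2) ℂ :=
  !![U 0 0, U 0 1; 0, 0]

/-- The lower half `Q` of a coin matrix `U`: first row zero, second row of `U`. -/
def lowerPart (U : Matrix (Fin 2) (Fin 2) ℂ) : Matrix (Fin 2) (Fin 2) ℂ :=
  !![0, 0; U 1 0, U 1 1]

/-- The amplitude `ψ_t(x) ∈ ℂ²` at time `t` and position `x` of the time-dependent quantum walk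
with coin matrices `U 0, U 1, …`, started at the origin in the state `φ`. -/
def amplitude (U : ℕ → Matrix (Fin 2) (Fin 2) ℂ) (φ : Fin 2 → ℂ) : ℕ → ℤ → Fin 2 → ℂ
  | 0 => fun x => if x = 0 then φ else 0
  | t + 1 => fun x =>
      upperPart (U t) *ᵥ amplitude U φ t (x + 1) + lowerPart (U t) *ᵥ amplitude U φ t (x - 1)

/-- `P(X_t = x) = ‖ψ_t(x)‖²`, the squared Euclidean norm of the amplitude. -/
def prob (U : ℕ → Matrix (Fin 2) (Fin 2) ℂ) (φ : Fin 2 → ℂ) (t : ℕ) (x : ℤ) : ℝ :=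
  ∑ j, ‖amplitude U φ t x j‖ ^ 2

/-- The law on `ℤ` of the position `X_t` of the walker at time `t`. -/
def positionLaw (U : ℕ → Matrix (Fin 2) (Fin 2) ℂ) (φ : Fin 2 → ℂ) (t : ℕ) : Measure ℤ :=
  Measure.sum fun x : ℤ => ENNReal.ofReal (prob U φ t x) • Measure.dirac x

/-- The matrix `R(k) = diag(e^{ik}, e^{-ik})`. -/
def rotation (k : ℝ) : Matrix (Fin 2) (Fin 2) ℂ :=
  !![Complex.exp (Complex.I * k), 0; 0, Complex.exp (-(Complex.I * k))]

/-- The coin `[[a, b e^{iw}], [c e^{-iw}, d]]`. -/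
def phaseCoin (a b c d : ℂ) (w : ℝ) : Matrix (Fin 2) (Fin 2) ℂ :=
  !![a, b * Complex.exp (Complex.I * w); c * Complex.exp (-(Complex.I * w)), d]

/-- The density `f_K(x; a)`. -/
def konnoDensity (a : ℂ) (x : ℝ) : ℝ :=
  (Set.Ioo (-‖a‖) ‖a‖).indicator
    (fun y => √(1 - ‖a‖ ^ 2) / (Real.pi * (1 - y ^ 2) * √(‖a‖ ^ 2 - y ^ 2))) x

/-- The limit density
`f_K(x; a) {1 - (|α|² - |β|² + (a α conj(b β) e^{-iw₀} + conj(a α) b β e^{iw₀}) / |a|²) x}`;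
the complex number whose real part is taken is the sum of two conjugates, hence real. -/
def limitDensity (a b α β : ℂ) (w₀ : ℝ) (x : ℝ) : ℝ :=
  konnoDensity a x *
    (1 - (‖α‖ ^ 2 - ‖β‖ ^ 2 +
      (a * α * star (b * β) * Complex.exp (-(Complex.I * w₀)) +
        star (a * α) * (b * β) * Complex.exp (Complex.I * w₀)).re / ‖a‖ ^ 2) * x)

/-- The measure on `ℝ` with density `limitDensity`: the law of the limit variable. -/
def limitLaw (a b α β : ℂ) (w₀ : ℝ) : Measure ℝ :=
  volume.withDensity fun x => ENNReal.ofReal (limitDensity a b α β w₀ x)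

end QuantumWalk

end

namespace QuantumWalk

/-! Because `w_t` is affine in `t`, the time dependence is a gauge: it changes each component of the
amplitude only by a unit phase (`amplitude_phaseCoin`), so the walk reduces to the constant coin
started from a rotated state.

With the coin in the normal form of `exists_eq_polarCoin`, one step in Fourier space is, up to a
global phase, a unitary matrix of determinant 1 and trace `2 cos θ`, where `θ(m) = arccos (‖a‖ cos
m)`. Hence it equals `cos θ + i sin θ N` with `N` a Hermitian involution, and its powers are
explicit (`amplitudeSeries_polarCoin`).

By Parseval, the characteristic function of `X_t / t` at `ξ` is an average over `k` of inner
products of the Fourier transforms at `k` and `k - ξ/t`. Since `t (θ(m - ξ/t) - θ(m))` tends to `-ξ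
θ'(m)`, dominated convergence gives its limit (`tendsto_sum_exp_mul_prob`).

Folding the limit integral along `m ↦ π - m`, which preserves the group velocity `θ'`, leaves
`e^{iξθ'}` with weight `1 - λ θ'` on `(-π/2, π/2)`, where `θ'` is injective
(`integral_limitIntegrand`). The substitution `x = θ'(m)` turns `dm/π` into `f_K(x; a) dx`
(`deriv_mul_konnoDensity`), and Lévy's continuity theorem concludes. -/

/-! ### Recursion for the amplitudes and removal of the time dependence. -/

theorem amplitude_succ_zero (U : ℕ → Matrix (Fin 2) (Fin 2) ℂ) (φ : Fin 2 → ℂ) (t : ℕ) (x : ℤ) :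
    amplitude U φ (t + 1) x 0 =
      U t 0 0 * amplitude U φ t (x + 1) 0 + U t 0 1 * amplitude U φ t (x + 1) 1 := by
  simp [amplitude, upperPart, lowerPart, dotProduct, Fin.sum_univ_two]

theorem amplitude_succ_one (U : ℕ → Matrix (Fin 2) (Fin 2) ℂ) (φ : Fin 2 → ℂ) (t : ℕ) (x : ℤ) :
    amplitude U φ (t + 1) x 1 =
      U t 1 0 * amplitude U φ t (x - 1) 0 + U t 1 1 * amplitude U φ t (x - 1) 1 := by
  simp [amplitude, upperPart, lowerPart, dotProduct, Fin.sum_univ_two]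

theorem phaseCoin_eq_rotation_mul (a b c d : ℂ) (w : ℝ) :
    phaseCoin a b c d w = rotation (w / 2) * !![a, b; c, d] * rotation (-(w / 2)) := by
  have h : Complex.exp (Complex.I * w) =
      Complex.exp (Complex.I * (w / 2)) * Complex.exp (Complex.I * (w / 2)) := by
    rw [← Complex.exp_add]; ring_nf
  have h' : Complex.exp (-(Complex.I * w)) =
      Complex.exp (-(Complex.I * (w / 2))) * Complex.exp (-(Complex.I * (w / 2))) := by
    rw [← Complex.exp_add]; ring_nf
  have h1 : Complex.exp (-(Complex.I * (w / 2))) * Complex.exp (Complex.I * (w / 2)) = 1 := by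
    rw [← Complex.exp_add]; simp
  ext i j
  fin_cases i <;> fin_cases j <;>
    simp [phaseCoin, rotation, Matrix.mul_apply, Fin.sum_univ_two]
  · linear_combination -a * h1
  · rw [h]; ring
  · rw [h']; ring
  · linear_combination -d * h1

/-- The upper phase depends only on `x + t` and the lower one only on `x - t`, so each is carried
along by its own shift. Their difference is `κ t + w`, exactly what the off-diagonal coin entries at
time `t` compensate. -/
theorem amplitude_phaseCoin (a b c d : ℂ) (κ w : ℝ) (φ : Fin 2 → ℂ) (t : ℕ) (x : ℤ) :
    amplitude (fun s => phaseCoin a b c d (κ * s + w)) φ t x 0 =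
        Complex.exp (Complex.I * ((κ * x + κ * t + w) / 2 : ℝ)) *
          amplitude (fun _ => !![a, b; c, d]) (rotation (-(w / 2)) *ᵥ φ) t x 0 ∧
      amplitude (fun s => phaseCoin a b c d (κ * s + w)) φ t x 1 =
        Complex.exp (Complex.I * ((κ * x - κ * t - w) / 2 : ℝ)) *
          amplitude (fun _ => !![a, b; c, d]) (rotation (-(w / 2)) *ᵥ φ) t x 1 := by
  induction t generalizing x with
  | zero =>
    by_cases hx : x = 0
    · subst hx
      constructor <;> simp [amplitude, rotation, ← mul_assoc, ← Complex.exp_add, neg_div] <;> rfl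
    · simp [amplitude, hx]
  | succ t ih =>
    simp only [amplitude_succ_zero, amplitude_succ_one, (ih _).1, (ih _).2]
    constructor
    · have h1 : Complex.exp (Complex.I * ((κ * (x + 1 : ℤ) + κ * t + w) / 2 : ℝ)) =
          Complex.exp (Complex.I * ((κ * x + κ * (t + 1 : ℕ) + w) / 2 : ℝ)) := by
        congr 1; push_cast; ring
      have h2 : Complex.exp (Complex.I * (κ * t + w : ℝ)) *
          Complex.exp (Complex.I * ((κ * (x + 1 : ℤ) - κ * t - w) / 2 : ℝ)) =
          Complex.exp (Complex.I * ((κ * x + κ * (t + 1 : ℕ) + w) / 2 : ℝ)) := by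
        rw [← Complex.exp_add]; congr 1; push_cast; ring
      simp only [phaseCoin, Matrix.of_apply, Matrix.cons_val', Matrix.cons_val_zero,
        Matrix.cons_val_one, Matrix.cons_val_fin_one]
      rw [← h2] at h1 ⊢
      rw [h1]
      ring
    · have h1 : Complex.exp (Complex.I * ((κ * (x - 1 : ℤ) - κ * t - w) / 2 : ℝ)) =
          Complex.exp (Complex.I * ((κ * x - κ * (t + 1 : ℕ) - w) / 2 : ℝ)) := by
        congr 1; push_cast; ring
      have h2 : Complex.exp (-(Complex.I * (κ * t + w : ℝ))) *
          Complex.exp (Complex.I * ((κ * (x - 1 : ℤ) + κ * t + w) / 2 : ℝ)) =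
          Complex.exp (Complex.I * ((κ * x - κ * (t + 1 : ℕ) - w) / 2 : ℝ)) := by
        rw [← Complex.exp_add]; congr 1; push_cast; ring
      simp only [phaseCoin, Matrix.of_apply, Matrix.cons_val', Matrix.cons_val_zero,
        Matrix.cons_val_one, Matrix.cons_val_fin_one]
      rw [← h2] at h1 ⊢
      rw [h1]
      ring

theorem prob_phaseCoin (a b c d : ℂ) (κ w : ℝ) (φ : Fin 2 → ℂ) (t : ℕ) (x : ℤ) :
    prob (fun s => phaseCoin a b c d (κ * s + w)) φ t x =
      prob (fun _ => !![a, b; c, d]) (rotation (-(w / 2)) *ᵥ φ) t x := by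
  obtain ⟨h0, h1⟩ := amplitude_phaseCoin a b c d κ w φ t x
  simp only [prob, Fin.sum_univ_two, h0, h1, norm_mul, Complex.norm_exp_I_mul_ofReal, one_mul]

/-! ### Fourier series of the amplitude and Parseval's identity. -/

theorem amplitude_eq_zero (U : ℕ → Matrix (Fin 2) (Fin 2) ℂ) (φ : Fin 2 → ℂ) {t : ℕ} {x : ℤ}
    (hx : x ∉ Finset.Icc (-(t : ℤ)) t) : amplitude U φ t x = 0 := by
  induction t generalizing x with
  | zero =>
    have : x ≠ 0 := by rintro rfl; simp at hx
    simp [amplitude, this]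
  | succ t ih =>
    have h1 : x + 1 ∉ Finset.Icc (-(t : ℤ)) t := by
      rw [Finset.mem_Icc] at hx ⊢; push_cast at hx; omega
    have h2 : x - 1 ∉ Finset.Icc (-(t : ℤ)) t := by
      rw [Finset.mem_Icc] at hx ⊢; push_cast at hx; omega
    simp [amplitude, ih h1, ih h2]

/-- The Fourier series `∑ₓ e^{-ikx} ψ_t(x)` of the amplitude. -/
noncomputable def amplitudeSeries (U : ℕ → Matrix (Fin 2) (Fin 2) ℂ) (φ : Fin 2 → ℂ) (t : ℕ)
    (k : ℝ) (j : Fin 2) : ℂ :=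
  ∑' x : ℤ, Complex.exp (-(Complex.I * (k * x : ℝ))) * amplitude U φ t x j

theorem amplitudeSeries_eq_sum (U : ℕ → Matrix (Fin 2) (Fin 2) ℂ) (φ : Fin 2 → ℂ) (t : ℕ)
    (k : ℝ) (j : Fin 2) :
    amplitudeSeries U φ t k j = ∑ x ∈ Finset.Icc (-(t : ℤ)) t,
      Complex.exp (-(Complex.I * (k * x : ℝ))) * amplitude U φ t x j :=
  tsum_eq_sum fun x hx => by simp [amplitude_eq_zero U φ hx]

theorem amplitudeSeries_zero (U : ℕ → Matrix (Fin 2) (Fin 2) ℂ) (φ : Fin 2 → ℂ) (k : ℝ)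
    (j : Fin 2) : amplitudeSeries U φ 0 k j = φ j := by
  simp [amplitudeSeries_eq_sum, amplitude]

theorem summable_amplitude_mul (U : ℕ → Matrix (Fin 2) (Fin 2) ℂ) (φ : Fin 2 → ℂ) (t : ℕ)
    (f : ℤ → ℂ) (j : Fin 2) : Summable fun x => f x * amplitude U φ t x j :=
  summable_of_ne_finset_zero (s := Finset.Icc (-(t : ℤ)) t)
    fun x hx => by simp [amplitude_eq_zero U φ hx]

theorem amplitudeSeries_succ_zero (U : ℕ → Matrix (Fin 2) (Fin 2) ℂ) (φ : Fin 2 → ℂ) (t : ℕ)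
    (k : ℝ) :
    amplitudeSeries U φ (t + 1) k 0 = Complex.exp (Complex.I * k) *
      (U t 0 0 * amplitudeSeries U φ t k 0 + U t 0 1 * amplitudeSeries U φ t k 1) := by
  unfold amplitudeSeries
  rw [← (Equiv.subRight (1 : ℤ)).tsum_eq, ← tsum_mul_left, ← tsum_mul_left,
    ← (Summable.mul_left _ (summable_amplitude_mul ..)).tsum_add
      (Summable.mul_left _ (summable_amplitude_mul ..)), ← tsum_mul_left]
  refine tsum_congr fun x => ?_
  have : Complex.exp (-(Complex.I * (k * (x - 1 : ℤ) : ℝ))) =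
      Complex.exp (Complex.I * k) * Complex.exp (-(Complex.I * (k * x : ℝ))) := by
    rw [← Complex.exp_add]; congr 1; push_cast; ring
  rw [Equiv.subRight_apply, amplitude_succ_zero, this, sub_add_cancel]
  ring

theorem amplitudeSeries_succ_one (U : ℕ → Matrix (Fin 2) (Fin 2) ℂ) (φ : Fin 2 → ℂ) (t : ℕ)
    (k : ℝ) :
    amplitudeSeries U φ (t + 1) k 1 = Complex.exp (-(Complex.I * k)) *
      (U t 1 0 * amplitudeSeries U φ t k 0 + U t 1 1 * amplitudeSeries U φ t k 1) := by
  unfold amplitudeSeries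
  rw [← (Equiv.addRight (1 : ℤ)).tsum_eq, ← tsum_mul_left, ← tsum_mul_left,
    ← (Summable.mul_left _ (summable_amplitude_mul ..)).tsum_add
      (Summable.mul_left _ (summable_amplitude_mul ..)), ← tsum_mul_left]
  refine tsum_congr fun x => ?_
  have : Complex.exp (-(Complex.I * (k * (x + 1 : ℤ) : ℝ))) =
      Complex.exp (-(Complex.I * k)) * Complex.exp (-(Complex.I * (k * x : ℝ))) := by
    rw [← Complex.exp_add]; congr 1; push_cast; ring
  rw [Equiv.coe_addRight, amplitude_succ_one, this, add_sub_cancel_right]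
  ring

theorem integral_exp_I_mul_int (n : ℤ) :
    ∫ k in (-Real.pi)..Real.pi, Complex.exp (Complex.I * (k * n : ℝ)) =
      if n = 0 then 2 * (Real.pi : ℂ) else 0 := by
  split_ifs with hn
  · subst hn; simp; ring
  · have hc : Complex.I * n ≠ 0 := mul_ne_zero Complex.I_ne_zero (by exact_mod_cast hn)
    have := integral_exp_mul_complex (a := -Real.pi) (b := Real.pi) hc
    have e : ∀ k : ℝ, Complex.I * ((k * n : ℝ) : ℂ) = Complex.I * n * k := by
      intro k; push_cast; ring
    simp_rw [e, this]
    have : Complex.exp (Complex.I * n * Real.pi) =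
        Complex.exp (Complex.I * n * (-Real.pi : ℝ)) := by
      rw [Complex.exp_eq_exp_iff_exists_int]
      exact ⟨n, by push_cast; ring⟩
    rw [this]; simp

/-- Parseval with a shift: translating the momentum by `ζ` multiplies the coefficient at `x` by
`e^{iζx}`, and orthogonality keeps only the diagonal terms. -/
theorem integral_conj_sum_mul_sum (S : Finset ℤ) (f : ℤ → ℂ) (ζ : ℝ) :
    ∫ k in (-Real.pi)..Real.pi,
        star (∑ x ∈ S, Complex.exp (-(Complex.I * (k * x : ℝ))) * f x) *
          ∑ x ∈ S, Complex.exp (-(Complex.I * ((k - ζ) * x : ℝ))) * f x =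
      2 * Real.pi * ∑ x ∈ S, Complex.exp (Complex.I * (ζ * x : ℝ)) * (‖f x‖ ^ 2 : ℝ) := by
  have e : ∀ k : ℝ, star (∑ x ∈ S, Complex.exp (-(Complex.I * (k * x : ℝ))) * f x) *
      ∑ x ∈ S, Complex.exp (-(Complex.I * ((k - ζ) * x : ℝ))) * f x =
      ∑ x ∈ S, ∑ y ∈ S, (star (f x) * f y * Complex.exp (Complex.I * (ζ * y : ℝ))) *
        Complex.exp (Complex.I * (k * (x - y : ℤ) : ℝ)) := by
    intro k
    rw [star_sum, Finset.sum_mul_sum]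
    refine Finset.sum_congr rfl fun x _ => Finset.sum_congr rfl fun y _ => ?_
    have h1 : star (Complex.exp (-(Complex.I * (k * x : ℝ)))) =
        Complex.exp (Complex.I * (k * x : ℝ)) := by
      rw [Complex.star_def, ← Complex.exp_conj]; simp
    have h2 : Complex.exp (Complex.I * (k * x : ℝ)) *
        Complex.exp (-(Complex.I * ((k - ζ) * y : ℝ))) =
        Complex.exp (Complex.I * (ζ * y : ℝ)) *
          Complex.exp (Complex.I * (k * (x - y : ℤ) : ℝ)) := by
      rw [← Complex.exp_add, ← Complex.exp_add]; congr 1; push_cast; ring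
    rw [star_mul', h1]
    linear_combination (star (f x) * f y) * h2
  simp_rw [e]
  rw [intervalIntegral.integral_finsetSum fun x _ => Continuous.intervalIntegrable
    (by fun_prop) _ _, Finset.mul_sum]
  refine Finset.sum_congr rfl fun x hx => ?_
  rw [intervalIntegral.integral_finsetSum fun x _ => Continuous.intervalIntegrable
    (by fun_prop) _ _]
  simp_rw [intervalIntegral.integral_const_mul, integral_exp_I_mul_int, sub_eq_zero]
  rw [Finset.sum_eq_single_of_mem x hx (fun y _ hy => by simp [hy.symm])]
  have : star (f x) * f x = ((‖f x‖ ^ 2 : ℝ) : ℂ) := by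
    rw [Complex.star_def, mul_comm, Complex.mul_conj, Complex.normSq_eq_norm_sq]
  rw [if_pos rfl, this]
  ring

/-- For `ζ = ξ / t` the sum on the right is the characteristic function of `X_t / t` at `ξ`, exact
for finite `t > 0`. -/
theorem integral_conj_amplitudeSeries_mul (U : ℕ → Matrix (Fin 2) (Fin 2) ℂ) (φ : Fin 2 → ℂ)
    (t : ℕ) (ζ : ℝ) :
    ∫ k in (-Real.pi)..Real.pi,
        ∑ j, star (amplitudeSeries U φ t k j) * amplitudeSeries U φ t (k - ζ) j =
      2 * Real.pi * ∑ x ∈ Finset.Icc (-(t : ℤ)) t,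
        Complex.exp (Complex.I * (ζ * x : ℝ)) * prob U φ t x := by
  simp_rw [amplitudeSeries_eq_sum]
  rw [intervalIntegral.integral_finsetSum fun x _ => Continuous.intervalIntegrable
    (by fun_prop) _ _]
  simp_rw [integral_conj_sum_mul_sum, prob, ← Finset.mul_sum, Complex.ofReal_sum, Finset.mul_sum]
  rw [Finset.sum_comm]

/-! ### Quasi-energy and explicit evolution in Fourier space. -/

/-- The sine of the quasi-energy, `√(1 - r² cos² m)`. -/
noncomputable def sineEnergy (r m : ℝ) : ℝ := √(1 - (r * Real.cos m) ^ 2)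

/-- The quasi-energy `arccos (r cos m)`: the eigenvalues of the Fourier transformed walk
operator are, up to a constant phase, its exponentials `e^{±iθ}`. -/
noncomputable def quasiEnergy (r m : ℝ) : ℝ := Real.arccos (r * Real.cos m)

/-- The group velocity `r sin m / √(1 - r² cos² m)`, the derivative of the quasi-energy. -/
noncomputable def groupVelocity (r m : ℝ) : ℝ := r * Real.sin m / sineEnergy r m

variable {r : ℝ}

theorem sq_mul_cos_lt_one (h0 : 0 ≤ r) (h1 : r < 1) (m : ℝ) : (r * Real.cos m) ^ 2 < 1 := by
  have : r ^ 2 < 1 := by nlinarith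
  nlinarith [Real.cos_sq_le_one m, sq_nonneg (Real.cos m), sq_nonneg r]

theorem sineEnergy_pos (h0 : 0 ≤ r) (h1 : r < 1) (m : ℝ) : 0 < sineEnergy r m :=
  Real.sqrt_pos.2 (by linarith [sq_mul_cos_lt_one h0 h1 m])

theorem sineEnergy_sq (h0 : 0 ≤ r) (h1 : r < 1) (m : ℝ) :
    sineEnergy r m ^ 2 = 1 - (r * Real.cos m) ^ 2 :=
  Real.sq_sqrt (by linarith [sq_mul_cos_lt_one h0 h1 m])

@[fun_prop]
theorem continuous_sineEnergy : Continuous (sineEnergy r) := by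
  unfold sineEnergy; fun_prop

@[fun_prop]
theorem continuous_groupVelocity (h0 : 0 ≤ r) (h1 : r < 1) : Continuous (groupVelocity r) :=
  Continuous.div (by fun_prop) (by fun_prop) fun m => (sineEnergy_pos h0 h1 m).ne'

theorem sin_quasiEnergy (r m : ℝ) : Real.sin (quasiEnergy r m) = sineEnergy r m :=
  Real.sin_arccos _

theorem cos_quasiEnergy (h0 : 0 ≤ r) (h1 : r < 1) (m : ℝ) :
    Real.cos (quasiEnergy r m) = r * Real.cos m := by
  have := abs_lt.1 ((sq_lt_one_iff_abs_lt_one _).1 (sq_mul_cos_lt_one h0 h1 m))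
  exact Real.cos_arccos this.1.le this.2.le

theorem hasDerivAt_quasiEnergy (h0 : 0 ≤ r) (h1 : r < 1) (m : ℝ) :
    HasDerivAt (quasiEnergy r) (groupVelocity r m) m := by
  have := abs_lt.1 ((sq_lt_one_iff_abs_lt_one _).1 (sq_mul_cos_lt_one h0 h1 m))
  have hd := (Real.hasDerivAt_arccos this.1.ne' this.2.ne).comp m
    ((Real.hasDerivAt_cos m).const_mul r)
  refine hd.congr_deriv ?_
  rw [groupVelocity, sineEnergy]
  ring

/-- The image of `φ` under the involution `N(m)` for which the normalized walk operator is
`cos θ + i sin θ N`. -/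
noncomputable def reflected (r : ℝ) (q : ℂ) (φ : Fin 2 → ℂ) (m : ℝ) : Fin 2 → ℂ :=
  ![(r * Real.sin m * φ 0 - Complex.I * Complex.exp (Complex.I * m) * q * φ 1) / sineEnergy r m,
    (Complex.I * Complex.exp (-(Complex.I * m)) * star q * φ 0 - r * Real.sin m * φ 1) /
      sineEnergy r m]

/-- The normalized Fourier transform `cos (tθ) φ + i sin (tθ) N φ` of the walk at time `t`. -/
noncomputable def evolved (r : ℝ) (q : ℂ) (φ : Fin 2 → ℂ) (t : ℕ) (m : ℝ) (j : Fin 2) : ℂ :=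
  Real.cos (t * quasiEnergy r m) * φ j +
    Complex.I * Real.sin (t * quasiEnergy r m) * reflected r q φ m j

/-- The unitary matrix `s [[r e^{iη}, q e^{iη}], [-conj q e^{-iη}, r e^{-iη}]]`. -/
noncomputable def polarCoin (s : ℂ) (η r : ℝ) (q : ℂ) : Matrix (Fin 2) (Fin 2) ℂ :=
  !![s * (r * Complex.exp (Complex.I * η)), s * (q * Complex.exp (Complex.I * η));
    -(s * (star q * Complex.exp (-(Complex.I * η)))), s * (r * Complex.exp (-(Complex.I * η)))]

theorem exp_I_mul_ofReal (m : ℝ) :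
    Complex.exp (Complex.I * m) = Real.cos m + Complex.I * Real.sin m := by
  rw [mul_comm, Complex.exp_mul_I]; push_cast; ring

theorem exp_neg_I_mul_ofReal (m : ℝ) :
    Complex.exp (-(Complex.I * m)) = Real.cos m - Complex.I * Real.sin m := by
  have := exp_I_mul_ofReal (-m)
  simp only [Complex.ofReal_neg, mul_neg, Real.cos_neg, Real.sin_neg] at this
  rw [this]; ring

theorem cos_sq_add_sin_sq_ofReal (m : ℝ) : (Real.cos m : ℂ) ^ 2 + (Real.sin m : ℂ) ^ 2 = 1 := by
  exact_mod_cast Real.cos_sq_add_sin_sq m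

variable {q : ℂ}

theorem mul_star_eq (hq : r ^ 2 + ‖q‖ ^ 2 = 1) : q * star q = 1 - (r : ℂ) ^ 2 := by
  rw [Complex.star_def, Complex.mul_conj, Complex.normSq_eq_norm_sq]
  exact_mod_cast (by linarith : ‖q‖ ^ 2 = 1 - r ^ 2)

theorem sineEnergy_sq_ofReal (h0 : 0 ≤ r) (h1 : r < 1) (m : ℝ) :
    (sineEnergy r m : ℂ) ^ 2 = 1 - ((r : ℂ) * Real.cos m) ^ 2 := by
  exact_mod_cast sineEnergy_sq h0 h1 m

theorem sineEnergy_ofReal_ne_zero (h0 : 0 ≤ r) (h1 : r < 1) (m : ℝ) :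
    (sineEnergy r m : ℂ) ≠ 0 := by
  exact_mod_cast (sineEnergy_pos h0 h1 m).ne'

/-- The step matrix `M` has determinant 1 and trace `2 r cos m = 2 cos θ`, so `M = cos θ + i sin θ
N` with `N² = 1`, and the recursion is the addition formula for angles. Here `hA` is the first row
of this formula applied to `φ`; `hB` is the same for `N φ` and encodes `N² = 1`. -/
theorem evolved_succ_zero (h0 : 0 ≤ r) (h1 : r < 1) (hq : r ^ 2 + ‖q‖ ^ 2 = 1)
    (φ : Fin 2 → ℂ) (t : ℕ) (m : ℝ) :
    evolved r q φ (t + 1) m 0 = Complex.exp (Complex.I * m) *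
      (r * evolved r q φ t m 0 + q * evolved r q φ t m 1) := by
  have hS := sineEnergy_ofReal_ne_zero h0 h1 m
  have hS2 := sineEnergy_sq_ofReal h0 h1 m
  have hcs := cos_sq_add_sin_sq_ofReal m
  have hqq := mul_star_eq hq
  have hA : Complex.exp (Complex.I * m) * (r * φ 0 + q * φ 1) =
      r * Real.cos m * φ 0 + Complex.I * sineEnergy r m * reflected r q φ m 0 := by
    simp only [reflected, exp_I_mul_ofReal, Matrix.cons_val_zero]
    field_simp
    linear_combination ((Real.cos m + Complex.I * Real.sin m) * q * φ 1) * Complex.I_sq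
  have hB : Complex.exp (Complex.I * m) *
      (r * reflected r q φ m 0 + q * reflected r q φ m 1) =
      r * Real.cos m * reflected r q φ m 0 + Complex.I * sineEnergy r m * φ 0 := by
    simp only [reflected, exp_I_mul_ofReal, exp_neg_I_mul_ofReal, Matrix.cons_val_zero,
      Matrix.cons_val_one, Matrix.cons_val_fin_one]
    field_simp
    linear_combination φ 0 * Complex.I *
        (((Real.cos m : ℂ) ^ 2 - Complex.I ^ 2 * (Real.sin m : ℂ) ^ 2) * hqq - hS2 -
          (Real.sin m : ℂ) ^ 2 * (1 - (r : ℂ) ^ 2) * Complex.I_sq + hcs) -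
      r * q * (Real.cos m + Complex.I * Real.sin m) * Real.sin m * φ 1 * Complex.I_sq
  have e : ((t + 1 : ℕ) : ℝ) * quasiEnergy r m = t * quasiEnergy r m + quasiEnergy r m := by
    push_cast; ring
  simp only [evolved, e, Real.cos_add, Real.sin_add, cos_quasiEnergy h0 h1, sin_quasiEnergy,
    Complex.ofReal_add, Complex.ofReal_sub, Complex.ofReal_mul]
  linear_combination -(Real.cos (t * quasiEnergy r m) : ℂ) * hA -
    Complex.I * Real.sin (t * quasiEnergy r m) * hB -
    Real.sin (t * quasiEnergy r m) * sineEnergy r m * φ 0 * Complex.I_sq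

theorem evolved_succ_one (h0 : 0 ≤ r) (h1 : r < 1) (hq : r ^ 2 + ‖q‖ ^ 2 = 1)
    (φ : Fin 2 → ℂ) (t : ℕ) (m : ℝ) :
    evolved r q φ (t + 1) m 1 = Complex.exp (-(Complex.I * m)) *
      (-star q * evolved r q φ t m 0 + r * evolved r q φ t m 1) := by
  have hS := sineEnergy_ofReal_ne_zero h0 h1 m
  have hS2 := sineEnergy_sq_ofReal h0 h1 m
  have hcs := cos_sq_add_sin_sq_ofReal m
  have hqq := mul_star_eq hq
  have hA : Complex.exp (-(Complex.I * m)) * (-star q * φ 0 + r * φ 1) =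
      r * Real.cos m * φ 1 + Complex.I * sineEnergy r m * reflected r q φ m 1 := by
    simp only [reflected, exp_neg_I_mul_ofReal, Matrix.cons_val_one, Matrix.cons_val_fin_one]
    field_simp
    linear_combination (-(Real.cos m - Complex.I * Real.sin m) * star q * φ 0) * Complex.I_sq
  have hB : Complex.exp (-(Complex.I * m)) *
      (-star q * reflected r q φ m 0 + r * reflected r q φ m 1) =
      r * Real.cos m * reflected r q φ m 1 + Complex.I * sineEnergy r m * φ 1 := by
    simp only [reflected, exp_I_mul_ofReal, exp_neg_I_mul_ofReal, Matrix.cons_val_zero,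
      Matrix.cons_val_one, Matrix.cons_val_fin_one]
    field_simp
    linear_combination φ 1 * Complex.I *
        (((Real.cos m : ℂ) ^ 2 - Complex.I ^ 2 * (Real.sin m : ℂ) ^ 2) * hqq - hS2 -
          (Real.sin m : ℂ) ^ 2 * (1 - (r : ℂ) ^ 2) * Complex.I_sq + hcs) -
      r * star q * (Real.cos m - Complex.I * Real.sin m) * Real.sin m * φ 0 * Complex.I_sq
  have e : ((t + 1 : ℕ) : ℝ) * quasiEnergy r m = t * quasiEnergy r m + quasiEnergy r m := by
    push_cast; ring
  simp only [evolved, e, Real.cos_add, Real.sin_add, cos_quasiEnergy h0 h1, sin_quasiEnergy,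
    Complex.ofReal_add, Complex.ofReal_sub, Complex.ofReal_mul]
  linear_combination -(Real.cos (t * quasiEnergy r m) : ℂ) * hA -
    Complex.I * Real.sin (t * quasiEnergy r m) * hB -
    Real.sin (t * quasiEnergy r m) * sineEnergy r m * φ 1 * Complex.I_sq

/-- The phase `η` of the coin merges with `e^{±ik}` and only translates the momentum; `s` factors
out of every step. -/
theorem amplitudeSeries_polarCoin (h0 : 0 ≤ r) (h1 : r < 1) (hq : r ^ 2 + ‖q‖ ^ 2 = 1)
    (s : ℂ) (η : ℝ) (φ : Fin 2 → ℂ) (t : ℕ) (k : ℝ) (j : Fin 2) :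
    amplitudeSeries (fun _ => polarCoin s η r q) φ t k j =
      s ^ t * evolved r q φ t (k + η) j := by
  induction t generalizing j with
  | zero => simp [amplitudeSeries_zero, evolved]
  | succ t ih =>
    have e1 : Complex.exp (Complex.I * (k + η : ℝ)) =
        Complex.exp (Complex.I * k) * Complex.exp (Complex.I * η) := by
      rw [← Complex.exp_add]; push_cast; ring_nf
    have e2 : Complex.exp (-(Complex.I * (k + η : ℝ))) =
        Complex.exp (-(Complex.I * k)) * Complex.exp (-(Complex.I * η)) := by
      rw [← Complex.exp_add]; push_cast; ring_nf
    fin_cases j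
    · simp only [Fin.zero_eta, amplitudeSeries_succ_zero, ih, evolved_succ_zero h0 h1 hq, e1]
      simp only [polarCoin, Matrix.of_apply, Matrix.cons_val', Matrix.cons_val_zero, Matrix.cons_val_one,
        Matrix.cons_val_fin_one]
      ring
    · simp only [Fin.mk_one, amplitudeSeries_succ_one, ih, evolved_succ_one h0 h1 hq, e2]
      simp only [polarCoin, Matrix.of_apply, Matrix.cons_val', Matrix.cons_val_zero, Matrix.cons_val_one,
        Matrix.cons_val_fin_one]
      ring

/-! ### Inner products of evolved states at two momenta. -/

/-- The expectation `⟨φ, N(m) φ⟩` of the involution `N(m)`. -/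
noncomputable def expectation (r : ℝ) (q : ℂ) (φ : Fin 2 → ℂ) (m : ℝ) : ℝ :=
  (r * Real.sin m * (‖φ 0‖ ^ 2 - ‖φ 1‖ ^ 2) +
    2 * (Real.sin m * (star (φ 0) * (q * φ 1)).re +
      Real.cos m * (star (φ 0) * (q * φ 1)).im)) / sineEnergy r m

theorem star_mul_self_eq_ofReal (z : ℂ) : star z * z = ((‖z‖ ^ 2 : ℝ) : ℂ) := by
  rw [Complex.star_def, mul_comm, Complex.mul_conj, Complex.normSq_eq_norm_sq]

theorem star_exp_I_mul_ofReal (m : ℝ) :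
    star (Complex.exp (Complex.I * m)) = Complex.exp (-(Complex.I * m)) := by
  rw [Complex.star_def, ← Complex.exp_conj]; simp

theorem star_exp_neg_I_mul_ofReal (m : ℝ) :
    star (Complex.exp (-(Complex.I * m))) = Complex.exp (Complex.I * m) := by
  rw [Complex.star_def, ← Complex.exp_conj]; simp

theorem star_ofReal (x : ℝ) : star (x : ℂ) = x := Complex.conj_ofReal x

theorem star_I : star Complex.I = -Complex.I := Complex.conj_I

theorem sum_star_mul_reflected (φ : Fin 2 → ℂ) (m : ℝ) :
    ∑ j, star (φ j) * reflected r q φ m j = expectation r q φ m := by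
  have hz : star (φ 0) * (q * φ 1) = ((star (φ 0) * (q * φ 1)).re : ℂ) +
      (star (φ 0) * (q * φ 1)).im * Complex.I := (Complex.re_add_im _).symm
  have hz' : star (φ 1) * (star q * φ 0) = ((star (φ 0) * (q * φ 1)).re : ℂ) -
      (star (φ 0) * (q * φ 1)).im * Complex.I := by
    have := congrArg star hz
    simp only [star_add, star_mul', star_star, star_ofReal, star_I] at this
    linear_combination this
  have h0 := star_mul_self_eq_ofReal (φ 0)
  have h1 := star_mul_self_eq_ofReal (φ 1)
  set x := (star (φ 0) * (q * φ 1)).re with hx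
  set y := (star (φ 0) * (q * φ 1)).im with hy
  simp only [expectation, Fin.sum_univ_two, reflected, exp_I_mul_ofReal, exp_neg_I_mul_ofReal,
    Matrix.cons_val_zero, Matrix.cons_val_one, Matrix.cons_val_fin_one, ← hx, ← hy]
  rw [mul_div_assoc', mul_div_assoc', ← add_div, Complex.ofReal_div]
  congr 1
  simp only [Complex.ofReal_add, Complex.ofReal_sub, Complex.ofReal_mul, Complex.ofReal_pow,
    Complex.ofReal_ofNat] at h0 h1 ⊢
  linear_combination ((r : ℂ) * (Real.sin m : ℂ)) * (h0 - h1) -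
    Complex.I * (Real.cos m + Complex.I * Real.sin m) * hz +
    Complex.I * (Real.cos m - Complex.I * Real.sin m) * hz' +
    (-2 * (Real.sin m : ℂ) * x - 2 * Real.cos m * y) * Complex.I_sq

theorem sum_star_reflected_mul (φ : Fin 2 → ℂ) (m : ℝ) :
    ∑ j, star (reflected r q φ m j) * φ j = expectation r q φ m := by
  rw [← star_ofReal (expectation r q φ m), ← sum_star_mul_reflected, star_sum]
  simp [mul_comm]

/-- `N` is an isometry: its cross terms cancel and its columns have squared norm `(r² sin² m + ‖q‖²)
/ sin² θ`, which is 1 as `sin² θ = 1 - r² cos² m`. -/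
theorem sum_star_reflected_mul_reflected (h0 : 0 ≤ r) (h1 : r < 1) (hq : r ^ 2 + ‖q‖ ^ 2 = 1)
    {φ : Fin 2 → ℂ} (hφ : ∑ j, ‖φ j‖ ^ 2 = 1) (m : ℝ) :
    ∑ j, star (reflected r q φ m j) * reflected r q φ m j = 1 := by
  have hS := sineEnergy_ofReal_ne_zero h0 h1 m
  have hS2 := sineEnergy_sq_ofReal h0 h1 m
  have hcs := cos_sq_add_sin_sq_ofReal m
  have hqq := mul_star_eq hq
  have hn : star (φ 0) * φ 0 + star (φ 1) * φ 1 = 1 := by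
    rw [star_mul_self_eq_ofReal, star_mul_self_eq_ofReal, ← Complex.ofReal_add,
      ← Fin.sum_univ_two (fun j => ‖φ j‖ ^ 2), hφ, Complex.ofReal_one]
  have hE : Complex.exp (Complex.I * m) * Complex.exp (-(Complex.I * m)) = 1 := by
    rw [← Complex.exp_add]; simp
  simp only [Fin.sum_univ_two, reflected, Matrix.cons_val_zero, Matrix.cons_val_one,
    Matrix.cons_val_fin_one, star_div₀, star_sub, star_mul', star_star, star_ofReal, star_I,
    star_exp_I_mul_ofReal, star_exp_neg_I_mul_ofReal]
  field_simp
  set E := Complex.exp (Complex.I * m)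
  set F := Complex.exp (-(Complex.I * m))
  set n := star (φ 0) * φ 0 + star (φ 1) * φ 1 with hn'
  have : (r * Real.sin m : ℂ) ^ 2 * n - Complex.I ^ 2 * (E * F) * (q * star q) * n =
      sineEnergy r m ^ 2 := by
    rw [hn, hE, hqq, Complex.I_sq, hS2]
    linear_combination (r : ℂ) ^ 2 * hcs
  rw [← this, hn']
  ring

/-- The grouping separates what survives the limit: the first two terms see `t` only through the
phase difference, while the oscillating products of sines and cosines multiply factors that vanish
as `m'` tends to `m`. -/
theorem sum_star_evolved_mul_evolved {φ : Fin 2 → ℂ} (hφ : ∑ j, ‖φ j‖ ^ 2 = 1) (t : ℕ)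
    (m m' : ℝ) :
    ∑ j, star (evolved r q φ t m j) * evolved r q φ t m' j =
      Real.cos (t * quasiEnergy r m' - t * quasiEnergy r m) +
      Complex.I * expectation r q φ m *
        Real.sin (t * quasiEnergy r m' - t * quasiEnergy r m) +
      (Complex.I * (Real.cos (t * quasiEnergy r m) * Real.sin (t * quasiEnergy r m') *
          (expectation r q φ m' - expectation r q φ m) : ℝ) +
        (Real.sin (t * quasiEnergy r m) * Real.sin (t * quasiEnergy r m') : ℝ) *
          (∑ j, star (reflected r q φ m j) * reflected r q φ m' j - 1)) := by
  have hn : ∑ j, star (φ j) * φ j = 1 := by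
    simp_rw [star_mul_self_eq_ofReal, ← Complex.ofReal_sum, hφ, Complex.ofReal_one]
  have h1 := sum_star_mul_reflected (r := r) (q := q) φ m'
  have h2 := sum_star_reflected_mul (r := r) (q := q) φ m
  simp only [Fin.sum_univ_two] at *
  simp only [evolved, star_add, star_mul', star_ofReal, star_I, Real.cos_sub, Real.sin_sub,
    Complex.ofReal_add, Complex.ofReal_sub, Complex.ofReal_mul]
  rw [← h1, ← h2]
  set C := (Real.cos (t * quasiEnergy r m) : ℂ)
  set C' := (Real.cos (t * quasiEnergy r m') : ℂ)
  set D := (Real.sin (t * quasiEnergy r m) : ℂ)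
  set D' := (Real.sin (t * quasiEnergy r m') : ℂ)
  linear_combination (C * C') * hn - D * D' * (star (reflected r q φ m 0) * reflected r q φ m' 0 +
    star (reflected r q φ m 1) * reflected r q φ m' 1) * Complex.I_sq

theorem sum_star_evolved_mul_self (h0 : 0 ≤ r) (h1 : r < 1) (hq : r ^ 2 + ‖q‖ ^ 2 = 1)
    {φ : Fin 2 → ℂ} (hφ : ∑ j, ‖φ j‖ ^ 2 = 1) (t : ℕ) (m : ℝ) :
    ∑ j, star (evolved r q φ t m j) * evolved r q φ t m j = 1 := by
  rw [sum_star_evolved_mul_evolved hφ, sum_star_reflected_mul_reflected h0 h1 hq hφ]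
  simp

theorem norm_evolved_le_one (h0 : 0 ≤ r) (h1 : r < 1) (hq : r ^ 2 + ‖q‖ ^ 2 = 1)
    {φ : Fin 2 → ℂ} (hφ : ∑ j, ‖φ j‖ ^ 2 = 1) (t : ℕ) (m : ℝ) (j : Fin 2) :
    ‖evolved r q φ t m j‖ ≤ 1 := by
  have h := sum_star_evolved_mul_self h0 h1 hq hφ t m
  simp_rw [star_mul_self_eq_ofReal, ← Complex.ofReal_sum] at h
  have h' : ∑ j, ‖evolved r q φ t m j‖ ^ 2 = 1 := by exact_mod_cast h
  have := Finset.single_le_sum (f := fun j => ‖evolved r q φ t m j‖ ^ 2)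
    (fun i _ => sq_nonneg _) (Finset.mem_univ j)
  rw [h'] at this
  exact (sq_le_one_iff₀ (norm_nonneg _)).1 this

/-- A bound uniform in `t` and both momenta, to dominate the integrand. -/
theorem norm_sum_star_evolved_mul_le (h0 : 0 ≤ r) (h1 : r < 1) (hq : r ^ 2 + ‖q‖ ^ 2 = 1)
    {φ : Fin 2 → ℂ} (hφ : ∑ j, ‖φ j‖ ^ 2 = 1) (t : ℕ) (m m' : ℝ) :
    ‖∑ j, star (evolved r q φ t m j) * evolved r q φ t m' j‖ ≤ 2 := by
  refine (norm_sum_le _ _).trans ((Finset.sum_le_card_nsmul _ _ 1 fun j _ => ?_).trans (by simp))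
  rw [norm_mul, norm_star]
  exact mul_le_one₀ (norm_evolved_le_one h0 h1 hq hφ t m j) (norm_nonneg _)
    (norm_evolved_le_one h0 h1 hq hφ t m' j)

theorem continuous_expectation (h0 : 0 ≤ r) (h1 : r < 1) (φ : Fin 2 → ℂ) :
    Continuous (expectation r q φ) :=
  Continuous.div (by fun_prop) (by fun_prop) fun m => (sineEnergy_pos h0 h1 m).ne'

theorem continuous_reflected (h0 : 0 ≤ r) (h1 : r < 1) (φ : Fin 2 → ℂ) (j : Fin 2) :
    Continuous fun m => reflected r q φ m j := by
  fin_cases j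
  · exact Continuous.div (by fun_prop) (Complex.continuous_ofReal.comp continuous_sineEnergy)
      fun m => sineEnergy_ofReal_ne_zero h0 h1 m
  · exact Continuous.div (by fun_prop) (Complex.continuous_ofReal.comp continuous_sineEnergy)
      fun m => sineEnergy_ofReal_ne_zero h0 h1 m

/-! ### Limit of the characteristic functions. -/

/-- The limit of the integrand in the characteristic function of `X_t / t`. -/
noncomputable def limitIntegrand (r : ℝ) (q : ℂ) (φ : Fin 2 → ℂ) (ξ m : ℝ) : ℂ :=
  Real.cos (ξ * groupVelocity r m) -
    Complex.I * expectation r q φ m * Real.sin (ξ * groupVelocity r m)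

/-- This is the difference quotient at 0 of `u ↦ θ(m - ξ u)`, evaluated at `u = 1/t`. -/
theorem tendsto_quasiEnergy_sub (h0 : 0 ≤ r) (h1 : r < 1) (ξ m : ℝ) :
    Tendsto (fun t : ℕ => t * quasiEnergy r (m - ξ / t) - t * quasiEnergy r m) atTop
      (𝓝 (-(ξ * groupVelocity r m))) := by
  have hd : HasDerivAt (fun u : ℝ => quasiEnergy r (m - ξ * u)) (-(ξ * groupVelocity r m)) 0 := by
    have h2 : HasDerivAt (fun u : ℝ => m - ξ * u) (-ξ) 0 := by
      simpa using ((hasDerivAt_id (0 : ℝ)).const_mul ξ).const_sub m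
    have h3 := hasDerivAt_quasiEnergy h0 h1 (m - ξ * 0)
    have h4 := h3.comp (0 : ℝ) h2
    rw [mul_zero, sub_zero, mul_neg, mul_comm] at h4
    exact h4
  have hs := (hasDerivAt_iff_tendsto_slope.1 hd).comp
    (tendsto_nhdsWithin_iff.2 ⟨tendsto_inv_atTop_nhds_zero_nat (𝕜 := ℝ), by
      filter_upwards [eventually_gt_atTop 0] with t ht
      simp only [Set.mem_compl_iff, Set.mem_singleton_iff, inv_eq_zero, Nat.cast_eq_zero]
      omega⟩)
  refine hs.congr fun t => ?_
  simp only [Function.comp_apply, slope_def_field, mul_zero, sub_zero, div_eq_mul_inv, inv_inv]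
  ring

theorem tendsto_sum_star_evolved (h0 : 0 ≤ r) (h1 : r < 1) (hq : r ^ 2 + ‖q‖ ^ 2 = 1)
    {φ : Fin 2 → ℂ} (hφ : ∑ j, ‖φ j‖ ^ 2 = 1) (ξ m : ℝ) :
    Tendsto (fun t : ℕ => ∑ j, star (evolved r q φ t m j) * evolved r q φ t (m - ξ / t) j) atTop
      (𝓝 (limitIntegrand r q φ ξ m)) := by
  simp_rw [sum_star_evolved_mul_evolved hφ]
  have hm : Tendsto (fun t : ℕ => m - ξ / t) atTop (𝓝 m) := by
    simpa using (tendsto_const_div_atTop_nhds_zero_nat ξ).const_sub m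
  have hθ := tendsto_quasiEnergy_sub h0 h1 ξ m
  have hlim : limitIntegrand r q φ ξ m = Real.cos (-(ξ * groupVelocity r m)) +
      Complex.I * expectation r q φ m * Real.sin (-(ξ * groupVelocity r m)) + (0 + 0) := by
    rw [limitIntegrand, Real.cos_neg, Real.sin_neg]; push_cast; ring
  rw [hlim]
  refine (Tendsto.add ?_ ?_).add (Tendsto.add ?_ ?_)
  · exact ((Complex.continuous_ofReal.comp Real.continuous_cos).tendsto _).comp hθ
  · exact (((Complex.continuous_ofReal.comp Real.continuous_sin).tendsto _).comp hθ).const_mul _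
  · have hG : Tendsto (fun t : ℕ => expectation r q φ (m - ξ / t) - expectation r q φ m) atTop
        (𝓝 0) := by
      have h := (((continuous_expectation (q := q) h0 h1 φ).tendsto m).comp hm).sub_const
        (expectation r q φ m)
      rwa [sub_self] at h
    refine squeeze_zero_norm (fun t => ?_) (tendsto_zero_iff_norm_tendsto_zero.1 hG)
    rw [norm_mul, Complex.norm_I, one_mul, Complex.norm_real, norm_mul, norm_mul]
    exact mul_le_of_le_one_left (norm_nonneg _)
      (mul_le_one₀ (Real.abs_cos_le_one _) (norm_nonneg _) (Real.abs_sin_le_one _))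
  · have hW : Tendsto (fun t : ℕ => ∑ j, star (reflected r q φ m j) *
        reflected r q φ (m - ξ / t) j - 1) atTop (𝓝 0) := by
      have : Continuous fun m' => ∑ j, star (reflected r q φ m j) * reflected r q φ m' j - 1 := by
        have := continuous_reflected (q := q) h0 h1 φ
        fun_prop
      have h := (this.tendsto m).comp hm
      rwa [sum_star_reflected_mul_reflected h0 h1 hq hφ, sub_self] at h
    refine squeeze_zero_norm (fun t => ?_) (tendsto_zero_iff_norm_tendsto_zero.1 hW)
    rw [norm_mul, Complex.norm_real, norm_mul]
    exact mul_le_of_le_one_left (norm_nonneg _)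
      (mul_le_one₀ (Real.abs_sin_le_one _) (norm_nonneg _) (Real.abs_sin_le_one _))

theorem prob_nonneg (U : ℕ → Matrix (Fin 2) (Fin 2) ℂ) (φ : Fin 2 → ℂ) (t : ℕ) (x : ℤ) :
    0 ≤ prob U φ t x := Finset.sum_nonneg fun _ _ => sq_nonneg _

theorem continuous_amplitudeSeries (U : ℕ → Matrix (Fin 2) (Fin 2) ℂ) (φ : Fin 2 → ℂ) (t : ℕ)
    (j : Fin 2) : Continuous fun k => amplitudeSeries U φ t k j := by
  simp_rw [amplitudeSeries_eq_sum]
  fun_prop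

theorem sum_star_amplitudeSeries_polarCoin (h0 : 0 ≤ r) (h1 : r < 1) (hq : r ^ 2 + ‖q‖ ^ 2 = 1)
    {s : ℂ} (hs : ‖s‖ = 1) (η : ℝ) (φ : Fin 2 → ℂ) (t : ℕ) (k k' : ℝ) :
    ∑ j, star (amplitudeSeries (fun _ => polarCoin s η r q) φ t k j) *
        amplitudeSeries (fun _ => polarCoin s η r q) φ t k' j =
      ∑ j, star (evolved r q φ t (k + η) j) * evolved r q φ t (k' + η) j := by
  refine Finset.sum_congr rfl fun j _ => ?_
  have : star (s ^ t) * s ^ t = 1 := by rw [star_mul_self_eq_ofReal]; simp [hs]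
  rw [amplitudeSeries_polarCoin h0 h1 hq, amplitudeSeries_polarCoin h0 h1 hq, star_mul']
  linear_combination (star (evolved r q φ t (k + η) j) * evolved r q φ t (k' + η) j) * this

theorem sum_prob_polarCoin (h0 : 0 ≤ r) (h1 : r < 1) (hq : r ^ 2 + ‖q‖ ^ 2 = 1)
    {s : ℂ} (hs : ‖s‖ = 1) (η : ℝ) {φ : Fin 2 → ℂ} (hφ : ∑ j, ‖φ j‖ ^ 2 = 1) (t : ℕ) :
    ∑ x ∈ Finset.Icc (-(t : ℤ)) t, prob (fun _ => polarCoin s η r q) φ t x = 1 := by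
  have h := integral_conj_amplitudeSeries_mul (fun _ => polarCoin s η r q) φ t 0
  simp_rw [sub_zero, sum_star_amplitudeSeries_polarCoin h0 h1 hq hs,
    sum_star_evolved_mul_self h0 h1 hq hφ] at h
  have hpi : (2 * Real.pi : ℂ) ≠ 0 := by simp [Real.pi_ne_zero]
  have : (∑ x ∈ Finset.Icc (-(t : ℤ)) t, prob (fun _ => polarCoin s η r q) φ t x : ℂ) = 1 := by
    apply mul_left_cancel₀ hpi
    simpa [two_mul] using h.symm
  exact_mod_cast this

theorem tendsto_sum_exp_mul_prob (h0 : 0 ≤ r) (h1 : r < 1) (hq : r ^ 2 + ‖q‖ ^ 2 = 1)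
    {s : ℂ} (hs : ‖s‖ = 1) (η : ℝ) {φ : Fin 2 → ℂ} (hφ : ∑ j, ‖φ j‖ ^ 2 = 1) (ξ : ℝ) :
    Tendsto (fun t : ℕ => 2 * (Real.pi : ℂ) * ∑ x ∈ Finset.Icc (-(t : ℤ)) t,
        Complex.exp (Complex.I * (ξ / t * x : ℝ)) * prob (fun _ => polarCoin s η r q) φ t x) atTop
      (𝓝 (∫ k in (-Real.pi)..Real.pi, limitIntegrand r q φ ξ (k + η))) := by
  simp_rw [← integral_conj_amplitudeSeries_mul]
  refine intervalIntegral.tendsto_integral_filter_of_dominated_convergence (fun _ => 2)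
    (.of_forall fun t => ?_) (.of_forall fun t => .of_forall fun k _ => ?_) (by simp)
    (.of_forall fun k _ => ?_)
  · have := continuous_amplitudeSeries (fun _ => polarCoin s η r q) φ t
    exact Continuous.aestronglyMeasurable (by fun_prop)
  · rw [sum_star_amplitudeSeries_polarCoin h0 h1 hq hs]
    exact norm_sum_star_evolved_mul_le h0 h1 hq hφ t _ _
  · simp_rw [sum_star_amplitudeSeries_polarCoin h0 h1 hq hs, sub_add_eq_add_sub]
    exact tendsto_sum_star_evolved h0 h1 hq hφ ξ (k + η)

/-! ### Symmetries of the limit integral and the drift. -/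

theorem sineEnergy_add_two_pi (r m : ℝ) : sineEnergy r (m + 2 * Real.pi) = sineEnergy r m := by
  rw [sineEnergy, sineEnergy, Real.cos_add_two_pi]

theorem sineEnergy_neg (r m : ℝ) : sineEnergy r (-m) = sineEnergy r m := by
  rw [sineEnergy, sineEnergy, Real.cos_neg]

theorem sineEnergy_pi_sub (r m : ℝ) : sineEnergy r (Real.pi - m) = sineEnergy r m := by
  rw [sineEnergy, sineEnergy, Real.cos_pi_sub, mul_neg, neg_sq]

theorem groupVelocity_neg (r m : ℝ) : groupVelocity r (-m) = -groupVelocity r m := by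
  rw [groupVelocity, groupVelocity, sineEnergy_neg, Real.sin_neg, mul_neg, neg_div]

theorem groupVelocity_pi_sub (r m : ℝ) : groupVelocity r (Real.pi - m) = groupVelocity r m := by
  rw [groupVelocity, groupVelocity, sineEnergy_pi_sub, Real.sin_pi_sub]

/-- The coefficient of `-x` in the limit density. -/
noncomputable def drift (r : ℝ) (q : ℂ) (φ : Fin 2 → ℂ) : ℝ :=
  ‖φ 0‖ ^ 2 - ‖φ 1‖ ^ 2 + 2 * (star (φ 0) * (q * φ 1)).re / r

/-- Under `m ↦ π - m` the cosine changes sign, so the imaginary part of the interference term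
cancels; what remains is proportional to `sin m / sin θ`, hence to the velocity. -/
theorem expectation_add_expectation_pi_sub (hr : r ≠ 0) (φ : Fin 2 → ℂ) (m : ℝ) :
    expectation r q φ m + expectation r q φ (Real.pi - m) =
      2 * (drift r q φ * groupVelocity r m) := by
  rw [expectation, expectation, drift, groupVelocity, sineEnergy_pi_sub, Real.sin_pi_sub,
    Real.cos_pi_sub]
  field_simp
  ring

/-- Cauchy–Schwarz for the unit vectors `(r, ‖q‖)` and `(|A - B|, 2y)`, the latter of norm 1 because
`(A - B)² + 4AB = (A + B)²`. This makes the limit density nonnegative. -/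
theorem abs_drift_mul_le (hr : 0 < r) (hq : r ^ 2 + ‖q‖ ^ 2 = 1) {φ : Fin 2 → ℂ}
    (hφ : ∑ j, ‖φ j‖ ^ 2 = 1) : |drift r q φ| * r ≤ 1 := by
  have hz := Complex.abs_re_le_norm (star (φ 0) * (q * φ 1))
  rw [norm_mul, norm_mul, norm_star] at hz
  rw [Fin.sum_univ_two] at hφ
  set x := (star (φ 0) * (q * φ 1)).re with hx
  have e : drift r q φ * r = r * (‖φ 0‖ ^ 2 - ‖φ 1‖ ^ 2) + 2 * x := by
    rw [drift, ← hx]; field_simp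
  rw [show |drift r q φ| * r = |drift r q φ * r| by rw [abs_mul, abs_of_pos hr], e]
  set A := ‖φ 0‖ ^ 2
  set B := ‖φ 1‖ ^ 2
  set y := ‖φ 0‖ * ‖φ 1‖ with hy
  have hy2 : y ^ 2 = A * B := mul_pow _ _ _
  have hxy : |x| ≤ ‖q‖ * y := hz.trans (le_of_eq (by rw [hy]; ring))
  have h1 : |r * (A - B) + 2 * x| ≤ r * |A - B| + ‖q‖ * (2 * y) := by
    refine (abs_add_le _ _).trans ?_
    rw [abs_mul, abs_mul, abs_of_pos hr, abs_two]
    linarith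
  have h2 : (r * |A - B| + ‖q‖ * (2 * y)) ^ 2 ≤ 1 := by
    have hAB : |A - B| ^ 2 + (2 * y) ^ 2 = 1 := by
      rw [sq_abs, mul_pow, hy2]; linear_combination (A + B + 1) * hφ
    have : (r * |A - B| + ‖q‖ * (2 * y)) ^ 2 ≤
        (r ^ 2 + ‖q‖ ^ 2) * (|A - B| ^ 2 + (2 * y) ^ 2) := by
      nlinarith [sq_nonneg (r * (2 * y) - ‖q‖ * |A - B|)]
    rwa [hq, hAB, one_mul] at this
  exact h1.trans (abs_le_one_iff_mul_self_le_one.2 (by rwa [← sq]) |> (le_abs_self _).trans)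

theorem continuous_limitIntegrand (h0 : 0 ≤ r) (h1 : r < 1) (φ : Fin 2 → ℂ) (ξ : ℝ) :
    Continuous (limitIntegrand r q φ ξ) := by
  have := continuous_groupVelocity h0 h1
  have := continuous_expectation (q := q) h0 h1 φ
  unfold limitIntegrand
  fun_prop

theorem periodic_limitIntegrand (r : ℝ) (q : ℂ) (φ : Fin 2 → ℂ) (ξ : ℝ) :
    Function.Periodic (limitIntegrand r q φ ξ) (2 * Real.pi) := fun m => by
  simp only [limitIntegrand, expectation, groupVelocity, sineEnergy_add_two_pi,
    Real.sin_add_two_pi, Real.cos_add_two_pi]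

theorem integral_limitIntegrand (h0 : 0 < r) (h1 : r < 1) (φ : Fin 2 → ℂ) (ξ η : ℝ) :
    ∫ k in (-Real.pi)..Real.pi, limitIntegrand r q φ ξ (k + η) =
      2 * ∫ m in (-(Real.pi / 2))..(Real.pi / 2),
        ((1 - drift r q φ * groupVelocity r m : ℝ) : ℂ) *
          Complex.exp (Complex.I * (ξ * groupVelocity r m : ℝ)) := by
  have hL := continuous_limitIntegrand (q := q) h0.le h1 φ ξ
  have hh := continuous_groupVelocity h0.le h1
  set f : ℝ → ℂ := fun m => ((1 - drift r q φ * groupVelocity r m : ℝ) : ℂ) *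
    Complex.exp (Complex.I * (ξ * groupVelocity r m : ℝ)) with hf
  have hfc : Continuous f := by fun_prop
  -- The folded integrand is twice the even part of `f`; the odd part integrates to zero over a
  -- symmetric interval, so `f` may replace it.
  have hsymm (m : ℝ) : limitIntegrand r q φ ξ m + limitIntegrand r q φ ξ (Real.pi - m) =
      f m + f (-m) := by
    have he := congrArg Complex.ofReal (expectation_add_expectation_pi_sub (q := q) h0.ne' φ m)
    simp only [Complex.ofReal_add, Complex.ofReal_mul, Complex.ofReal_ofNat] at he
    simp only [hf, limitIntegrand, groupVelocity_neg, groupVelocity_pi_sub, exp_I_mul_ofReal,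
      mul_neg, Real.cos_neg, Real.sin_neg]
    simp only [Complex.ofReal_sub, Complex.ofReal_neg,
      Complex.ofReal_mul, Complex.ofReal_one]
    linear_combination -(Complex.I * Real.sin (ξ * groupVelocity r m)) * he
  -- Periodicity absorbs `η` and lets the period start at `-π/2`, so that `m ↦ π - m` exchanges its
  -- two halves.
  have h1 : ∫ k in (-Real.pi)..Real.pi, limitIntegrand r q φ ξ (k + η) =
      ∫ m in (-(Real.pi / 2))..(-(Real.pi / 2) + 2 * Real.pi), limitIntegrand r q φ ξ m := by
    rw [intervalIntegral.integral_comp_add_right (limitIntegrand r q φ ξ),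
      ← (periodic_limitIntegrand r q φ ξ).intervalIntegral_add_eq (-Real.pi + η)]
    congr 1; ring
  have h2 : ∫ m in (Real.pi / 2)..(-(Real.pi / 2) + 2 * Real.pi), limitIntegrand r q φ ξ m =
      ∫ m in (-(Real.pi / 2))..(Real.pi / 2), limitIntegrand r q φ ξ (Real.pi - m) := by
    rw [intervalIntegral.integral_comp_sub_left (limitIntegrand r q φ ξ)]
    congr 1 <;> ring
  have h3 : ∫ m in (-(Real.pi / 2))..(Real.pi / 2), f (-m) =
      ∫ m in (-(Real.pi / 2))..(Real.pi / 2), f m := by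
    rw [intervalIntegral.integral_comp_neg f, neg_neg]
  rw [h1, ← intervalIntegral.integral_add_adjacent_intervals (b := Real.pi / 2)
      (hL.intervalIntegrable _ _) (hL.intervalIntegrable _ _), h2,
    ← intervalIntegral.integral_add (hL.intervalIntegrable _ _)
      (Continuous.intervalIntegrable (by fun_prop) _ _)]
  simp_rw [hsymm]
  rw [intervalIntegral.integral_add (hfc.intervalIntegrable _ _)
      (Continuous.intervalIntegrable (by fun_prop) _ _), h3, two_mul]

/-! ### The group velocity as a change of variables. -/

theorem hasDerivAt_groupVelocity (h0 : 0 ≤ r) (h1 : r < 1) (m : ℝ) :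
    HasDerivAt (groupVelocity r) (r * Real.cos m * (1 - r ^ 2) / sineEnergy r m ^ 3) m := by
  have hS := sineEnergy_pos h0 h1 m
  have hS2 := sineEnergy_sq h0 h1 m
  have hd : HasDerivAt (sineEnergy r)
      (r ^ 2 * Real.cos m * Real.sin m / sineEnergy r m) m := by
    have h := ((((Real.hasDerivAt_cos m).const_mul r).pow 2).const_sub 1).sqrt
      (by linarith [sq_mul_cos_lt_one h0 h1 m] : 1 - (r * Real.cos m) ^ 2 ≠ 0)
    refine h.congr_deriv ?_
    change _ / (2 * sineEnergy r m) = _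
    field_simp
    simp
    ring
  refine (((Real.hasDerivAt_sin m).const_mul r).div hd hS.ne').congr_deriv ?_
  field_simp
  rw [hS2]
  linear_combination -r ^ 3 * Real.cos m * Real.sin_sq_add_cos_sq m

theorem strictMonoOn_groupVelocity (h0 : 0 < r) (h1 : r < 1) :
    StrictMonoOn (groupVelocity r) (Set.Icc (-(Real.pi / 2)) (Real.pi / 2)) := by
  refine strictMonoOn_of_deriv_pos (convex_Icc _ _)
    (continuous_groupVelocity h0.le h1).continuousOn fun m hm => ?_
  rw [interior_Icc] at hm
  rw [(hasDerivAt_groupVelocity h0.le h1 m).deriv]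
  have := Real.cos_pos_of_mem_Ioo hm
  have := sineEnergy_pos h0.le h1 m
  have : 0 < 1 - r ^ 2 := by nlinarith
  positivity

theorem groupVelocity_pi_div_two (r : ℝ) : groupVelocity r (Real.pi / 2) = r := by
  simp [groupVelocity, sineEnergy]

theorem image_groupVelocity (h0 : 0 < r) (h1 : r < 1) :
    groupVelocity r '' Set.Ioo (-(Real.pi / 2)) (Real.pi / 2) = Set.Ioo (-r) r := by
  have hpi : -(Real.pi / 2) ≤ Real.pi / 2 := by linarith [Real.pi_pos]
  have hmono := strictMonoOn_groupVelocity h0 h1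
  have hr := groupVelocity_pi_div_two r
  have hl : groupVelocity r (-(Real.pi / 2)) = -r := by rw [groupVelocity_neg, hr]
  refine Set.Subset.antisymm ?_ ?_
  · rintro _ ⟨m, hm, rfl⟩
    have h2 := hmono (Set.left_mem_Icc.2 hpi) (Set.Ioo_subset_Icc_self hm) hm.1
    have h3 := hmono (Set.Ioo_subset_Icc_self hm) (Set.right_mem_Icc.2 hpi) hm.2
    rw [hl] at h2
    rw [hr] at h3
    exact ⟨h2, h3⟩
  · have := intermediate_value_Ioo hpi (continuous_groupVelocity h0.le h1).continuousOn
    rwa [hl, hr] at this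

/-- In other words, `f_K` is the density of the group velocity when `m` is uniform on `(-π/2, π/2)`.
Both factors of its denominator become explicit in `m`, by `e1` and `e2`. -/
theorem deriv_mul_konnoDensity {a : ℂ} (h0 : 0 < ‖a‖) (h1 : ‖a‖ < 1) {m : ℝ}
    (hm : m ∈ Set.Ioo (-(Real.pi / 2)) (Real.pi / 2)) :
    |‖a‖ * Real.cos m * (1 - ‖a‖ ^ 2) / sineEnergy ‖a‖ m ^ 3| *
      konnoDensity a (groupVelocity ‖a‖ m) = Real.pi⁻¹ := by
  have hmem : groupVelocity ‖a‖ m ∈ Set.Ioo (-‖a‖) ‖a‖ :=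
    image_groupVelocity h0 h1 ▸ Set.mem_image_of_mem _ hm
  rw [konnoDensity, Set.indicator_of_mem hmem]
  set r := ‖a‖
  have hS := sineEnergy_pos h0.le h1 m
  have hS2 := sineEnergy_sq h0.le h1 m
  have hc := Real.cos_pos_of_mem_Ioo hm
  have hr : 0 < 1 - r ^ 2 := by nlinarith
  have hsq : √(1 - r ^ 2) ^ 2 = 1 - r ^ 2 := Real.sq_sqrt hr.le
  have hsp : 0 < √(1 - r ^ 2) := Real.sqrt_pos.2 hr
  have e1 : 1 - groupVelocity r m ^ 2 = (1 - r ^ 2) / sineEnergy r m ^ 2 := by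
    rw [groupVelocity]
    field_simp
    rw [hS2]
    linear_combination -r ^ 2 * Real.sin_sq_add_cos_sq m
  have e2 : r ^ 2 - groupVelocity r m ^ 2 =
      (r * Real.cos m * √(1 - r ^ 2) / sineEnergy r m) ^ 2 := by
    rw [groupVelocity, div_pow, div_pow, mul_pow _ (√(1 - r ^ 2)), hsq]
    field_simp
    rw [hS2]
    linear_combination -Real.sin_sq_add_cos_sq m
  rw [e1, e2, Real.sqrt_sq (by positivity), abs_of_pos (by positivity)]
  field_simp

theorem measurable_konnoDensity (a : ℂ) : Measurable (konnoDensity a) :=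
  Measurable.indicator (by fun_prop) measurableSet_Ioo

theorem konnoDensity_nonneg {a : ℂ} (h1 : ‖a‖ < 1) (x : ℝ) : 0 ≤ konnoDensity a x := by
  refine Set.indicator_nonneg (fun y hy => ?_) x
  have : y ^ 2 < 1 := by
    have := sq_lt_sq' hy.1 hy.2
    nlinarith [norm_nonneg a]
  have : 0 < 1 - y ^ 2 := by linarith
  have := Real.pi_pos
  positivity

theorem konnoDensity_of_notMem {a : ℂ} {x : ℝ} (hx : x ∉ Set.Ioo (-‖a‖) ‖a‖) :
    konnoDensity a x = 0 := Set.indicator_of_notMem hx _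

theorem konnoDensity_mul_nonneg {a : ℂ} (h1 : ‖a‖ < 1) {l : ℝ} (hl : |l| * ‖a‖ ≤ 1) (x : ℝ) :
    0 ≤ konnoDensity a x * (1 - l * x) := by
  by_cases hx : x ∈ Set.Ioo (-‖a‖) ‖a‖
  · refine mul_nonneg (konnoDensity_nonneg h1 x) (sub_nonneg.2 ((le_abs_self _).trans ?_))
    rw [abs_mul]
    exact (mul_le_mul_of_nonneg_left (abs_lt.2 hx).le (abs_nonneg l)).trans hl
  · rw [konnoDensity_of_notMem hx, zero_mul]

theorem integral_konnoDensity_mul {a : ℂ} (h0 : 0 < ‖a‖) (h1 : ‖a‖ < 1) (l : ℝ) (g : ℝ → ℂ) :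
    ∫ x, (konnoDensity a x * (1 - l * x)) • g x =
      (Real.pi : ℂ)⁻¹ * ∫ m in (-(Real.pi / 2))..(Real.pi / 2),
        ((1 - l * groupVelocity ‖a‖ m : ℝ) : ℂ) * g (groupVelocity ‖a‖ m) := by
  rw [← setIntegral_eq_integral_of_forall_compl_eq_zero (s := Set.Ioo (-‖a‖) ‖a‖)
      fun x hx => by rw [konnoDensity_of_notMem hx, zero_mul, zero_smul],
    ← image_groupVelocity h0 h1,
    integral_image_eq_integral_abs_deriv_smul measurableSet_Ioo
      (fun m _ => (hasDerivAt_groupVelocity h0.le h1 m).hasDerivWithinAt)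
      ((strictMonoOn_groupVelocity h0 h1).injOn.mono Set.Ioo_subset_Icc_self),
    intervalIntegral.integral_of_le (by linarith [Real.pi_pos]), ← integral_Ioc_eq_integral_Ioo,
    ← integral_const_mul, integral_Ioc_eq_integral_Ioo, integral_Ioc_eq_integral_Ioo]
  refine setIntegral_congr_fun measurableSet_Ioo fun m hm => ?_
  have := deriv_mul_konnoDensity h0 h1 hm
  rw [smul_smul, ← mul_assoc, this, Complex.real_smul]
  push_cast
  ring

/-- The velocity is odd in `m`, so the linear term does not contribute to the mass; the bound on `l`
keeps `ENNReal.ofReal` from truncating. -/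
theorem lintegral_konnoDensity_mul {a : ℂ} (h0 : 0 < ‖a‖) (h1 : ‖a‖ < 1) {l : ℝ}
    (hl : |l| * ‖a‖ ≤ 1) :
    ∫⁻ x, ENNReal.ofReal (konnoDensity a x * (1 - l * x)) = 1 := by
  have hh := continuous_groupVelocity h0.le h1
  have hIoo : ∫⁻ x, ENNReal.ofReal (konnoDensity a x * (1 - l * x)) =
      ∫⁻ x in Set.Ioo (-‖a‖) ‖a‖, ENNReal.ofReal (konnoDensity a x * (1 - l * x)) := by
    rw [← lintegral_indicator measurableSet_Ioo, Set.indicator_eq_self.2]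
    intro x hx
    by_contra hx'
    simp [konnoDensity_of_notMem hx'] at hx
  rw [hIoo, ← image_groupVelocity h0 h1,
    lintegral_image_eq_lintegral_abs_deriv_mul measurableSet_Ioo
      (fun m _ => (hasDerivAt_groupVelocity h0.le h1 m).hasDerivWithinAt)
      ((strictMonoOn_groupVelocity h0 h1).injOn.mono Set.Ioo_subset_Icc_self)]
  have hodd : ∫ m in (-(Real.pi / 2))..(Real.pi / 2), groupVelocity ‖a‖ m = 0 := by
    have h := intervalIntegral.integral_comp_neg (groupVelocity ‖a‖)
      (a := -(Real.pi / 2)) (b := Real.pi / 2)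
    simp_rw [groupVelocity_neg, intervalIntegral.integral_neg, neg_neg] at h
    linarith
  have hint : ∫ m in (-(Real.pi / 2))..(Real.pi / 2),
      Real.pi⁻¹ * (1 - l * groupVelocity ‖a‖ m) = 1 := by
    rw [intervalIntegral.integral_const_mul, intervalIntegral.integral_sub
      (by simp) (Continuous.intervalIntegrable (by fun_prop) _ _),
      intervalIntegral.integral_const_mul, hodd]
    simp [Real.pi_ne_zero]
  rw [intervalIntegral.integral_of_le (by linarith [Real.pi_pos]),
    integral_Ioc_eq_integral_Ioo] at hint
  have hnn : ∀ m ∈ Set.Ioo (-(Real.pi / 2)) (Real.pi / 2),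
      |‖a‖ * Real.cos m * (1 - ‖a‖ ^ 2) / sineEnergy ‖a‖ m ^ 3| *
        (konnoDensity a (groupVelocity ‖a‖ m) * (1 - l * groupVelocity ‖a‖ m)) =
      Real.pi⁻¹ * (1 - l * groupVelocity ‖a‖ m) := fun m hm => by
    rw [← mul_assoc, deriv_mul_konnoDensity h0 h1 hm]
  refine Eq.trans ?_ (congrArg ENNReal.ofReal hint |>.trans ENNReal.ofReal_one)
  rw [ofReal_integral_eq_lintegral_ofReal]
  · refine setLIntegral_congr_fun measurableSet_Ioo fun m hm => ?_
    rw [← hnn m hm, ENNReal.ofReal_mul (abs_nonneg _)]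
  · exact (Continuous.integrableOn_Icc (by fun_prop)).mono_set Set.Ioo_subset_Icc_self
  · filter_upwards [ae_restrict_mem measurableSet_Ioo] with m hm
    rw [← hnn m hm]
    exact mul_nonneg (abs_nonneg _) (konnoDensity_mul_nonneg h1 hl _)

/-! ### The position law as a finitely supported measure. -/

theorem isProbabilityMeasure_positionLaw {U : ℕ → Matrix (Fin 2) (Fin 2) ℂ} {φ : Fin 2 → ℂ}
    {t : ℕ} (h : ∑ x ∈ Finset.Icc (-(t : ℤ)) t, prob U φ t x = 1) :
    IsProbabilityMeasure (positionLaw U φ t) := by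
  refine ⟨?_⟩
  rw [positionLaw, Measure.sum_apply _ MeasurableSet.univ]
  simp only [Measure.smul_apply, measure_univ, smul_eq_mul, mul_one]
  rw [tsum_eq_sum (s := Finset.Icc (-(t : ℤ)) t)
      fun x hx => by simp [prob, amplitude_eq_zero U φ hx],
    ← ENNReal.ofReal_sum_of_nonneg fun x _ => prob_nonneg U φ t x, h, ENNReal.ofReal_one]

theorem integral_positionLaw (U : ℕ → Matrix (Fin 2) (Fin 2) ℂ) (φ : Fin 2 → ℂ) (t : ℕ)
    [IsProbabilityMeasure (positionLaw U φ t)] {f : ℤ → ℂ} (hf : ∀ x, ‖f x‖ ≤ 1) :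
    ∫ x, f x ∂positionLaw U φ t =
      ∑ x ∈ Finset.Icc (-(t : ℤ)) t, f x * prob U φ t x := by
  have hint : Integrable f (positionLaw U φ t) :=
    Integrable.of_bound (measurable_of_countable f).aestronglyMeasurable 1 (.of_forall hf)
  rw [positionLaw] at hint ⊢
  rw [integral_sum_measure hint, tsum_eq_sum (s := Finset.Icc (-(t : ℤ)) t)
    fun x hx => by simp [prob, amplitude_eq_zero U φ hx]]
  refine Finset.sum_congr rfl fun x _ => ?_
  rw [integral_smul_measure, integral_dirac, ENNReal.toReal_ofReal (prob_nonneg U φ t x),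
    Complex.real_smul, mul_comm]

/-! ### Normal form of a unitary coin. -/

/-- Dividing by a square root `s` of the determinant leaves a matrix of determinant 1, and `η` is
the argument of its upper left entry. The last conjunct expresses `q` through `a` and `b` alone, as
the limit density requires. -/
theorem exists_eq_polarCoin {a b c d : ℂ} (hU : !![a, b; c, d] ∈ Matrix.unitaryGroup (Fin 2) ℂ) :
    ∃ (s : ℂ) (η : ℝ) (q : ℂ), ‖s‖ = 1 ∧ ‖a‖ ^ 2 + ‖q‖ ^ 2 = 1 ∧
      !![a, b; c, d] = polarCoin s η ‖a‖ q ∧ ‖q‖ = ‖b‖ ∧ ‖a‖ * q = star a * b := by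
  have hU' := Matrix.mem_unitaryGroup_iff.1 hU
  have h00 := congrFun (congrFun hU' 0) 0
  have h10 := congrFun (congrFun hU' 1) 0
  simp [Matrix.mul_apply, Fin.sum_univ_two, Matrix.star_apply] at h00 h10
  have hdet : a * d - b * c ∈ unitary ℂ := by
    rw [← Matrix.det_fin_two_of]
    exact Matrix.det_of_mem_unitary hU
  set D := a * d - b * c with hD
  -- Comparison of the adjugate with the adjoint gives the second row from the first.
  have hd : d = D * star a := by
    simp only [Complex.star_def]
    linear_combination (-d) * h00 + b * h10
  have hc : c = -(D * star b) := by
    simp only [Complex.star_def]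
    linear_combination (-c) * h00 + a * h10
  have hDn : ‖D‖ = 1 := CStarRing.norm_of_mem_unitary hdet
  set s := Complex.exp (Complex.I * (D.arg / 2 : ℝ)) with hs
  have hsn : ‖s‖ = 1 := Complex.norm_exp_I_mul_ofReal _
  have hss : star s * s = 1 := by rw [star_mul_self_eq_ofReal, hsn]; simp
  have hsD : s * s = D := by
    rw [hs, ← Complex.exp_add]
    conv_rhs => rw [← Complex.norm_mul_exp_arg_mul_I D, hDn]
    push_cast
    rw [one_mul]
    ring_nf
  set η := (star s * a).arg with hη
  set E := Complex.exp (Complex.I * η) with hE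
  have hEn : ‖E‖ = 1 := Complex.norm_exp_I_mul_ofReal _
  have hEE : star E * E = 1 := by rw [star_mul_self_eq_ofReal, hEn]; simp
  have hF : Complex.exp (-(Complex.I * η)) = star E := (star_exp_I_mul_ofReal η).symm
  have ha : a = s * (‖a‖ * E) := by
    have h := Complex.norm_mul_exp_arg_mul_I (star s * a)
    rw [norm_mul, norm_star, hsn, one_mul, ← hη, mul_comm (η : ℂ), ← hE] at h
    rw [h]
    linear_combination -a * hss
  have hb : b = s * (star s * star E * b * E) := by
    linear_combination -b * hss - (s * star s * b) * hEE
  have ha' : star a = star s * (‖a‖ * star E) := by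
    have := congrArg star ha
    simpa only [star_mul', star_ofReal] using this
  have hqn : ‖star s * star E * b‖ = ‖b‖ := by simp [hsn, hEn]
  refine ⟨s, η, star s * star E * b, hsn, ?_, ?_, hqn, ?_⟩
  · rw [hqn]
    have := h00
    rw [Complex.mul_conj, Complex.mul_conj, Complex.normSq_eq_norm_sq,
      Complex.normSq_eq_norm_sq] at this
    exact_mod_cast this
  · have e0 : c = -(s * (star (star s * star E * b) * star E)) := by
      rw [hc, ← hsD]
      simp only [star_mul', star_star]
      linear_combination s * s * star b * hEE
    have e1 : d = s * (‖a‖ * star E) := by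
      rw [hd, ha', ← hsD]
      linear_combination s * ‖a‖ * star E * hss
    rw [polarCoin, ← hE, hF, ← e0, ← e1, ← ha, ← hb]
  · rw [ha']; ring

/-! ### Identification of the limit law and convergence in distribution. -/

theorem rotation_mulVec (k : ℝ) (α β : ℂ) :
    rotation k *ᵥ ![α, β] =
      ![Complex.exp (Complex.I * k) * α, Complex.exp (-(Complex.I * k)) * β] := by
  ext j
  fin_cases j <;> simp [rotation, mul_comm]

theorem sum_norm_sq_rotation_mulVec (k : ℝ) (α β : ℂ) :
    ∑ j, ‖(rotation k *ᵥ ![α, β]) j‖ ^ 2 = ‖α‖ ^ 2 + ‖β‖ ^ 2 := by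
  have h : ‖Complex.exp (-(Complex.I * k))‖ = 1 := by
    rw [← star_exp_I_mul_ofReal, norm_star, Complex.norm_exp_I_mul_ofReal]
  rw [rotation_mulVec]
  simp [Fin.sum_univ_two, Complex.norm_exp_I_mul_ofReal, h]

/-- The opposite half phases of the rotated state combine to `e^{iw}` in the interference term, and
the two conjugate summands of the density give twice its real part. -/
theorem limitDensity_eq {a b q : ℂ} (ha : a ≠ 0) (hq : ‖a‖ * q = star a * b) (α β : ℂ)
    (w x : ℝ) :
    limitDensity a b α β w x = konnoDensity a x *
      (1 - drift ‖a‖ q (rotation (-(w / 2)) *ᵥ ![α, β]) * x) := by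
  have hna : ‖a‖ ≠ 0 := norm_ne_zero_iff.2 ha
  have hφ := rotation_mulVec (-(w / 2)) α β
  have hn : ‖Complex.exp (-(Complex.I * (-(w / 2) : ℝ)))‖ = 1 := by
    rw [← star_exp_I_mul_ofReal, norm_star, Complex.norm_exp_I_mul_ofReal]
  have hz : ‖a‖ * (star (Complex.exp (Complex.I * (-(w / 2) : ℝ)) * α) *
      (q * (Complex.exp (-(Complex.I * (-(w / 2) : ℝ))) * β))) =
      star (a * α) * (b * β) * Complex.exp (Complex.I * w) := by
    have e : Complex.exp (Complex.I * w) = Complex.exp (-(Complex.I * (-(w / 2) : ℝ))) *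
        Complex.exp (-(Complex.I * (-(w / 2) : ℝ))) := by
      rw [← Complex.exp_add]; push_cast; ring_nf
    rw [star_mul', star_exp_I_mul_ofReal, star_mul', e]
    linear_combination (star α * β * Complex.exp (-(Complex.I * (-(w / 2) : ℝ))) ^ 2) * hq
  have hre : (a * α * star (b * β) * Complex.exp (-(Complex.I * w)) +
      star (a * α) * (b * β) * Complex.exp (Complex.I * w)).re =
      2 * (star (a * α) * (b * β) * Complex.exp (Complex.I * w)).re := by
    have : a * α * star (b * β) * Complex.exp (-(Complex.I * w)) =
        star (star (a * α) * (b * β) * Complex.exp (Complex.I * w)) := by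
      simp only [star_mul', star_star, star_exp_I_mul_ofReal]
    rw [this, Complex.add_re, Complex.star_def, Complex.conj_re, two_mul]
  rw [limitDensity, hre, ← hz, Complex.re_ofReal_mul, drift, hφ]
  simp only [Matrix.cons_val_zero, Matrix.cons_val_one, Matrix.cons_val_fin_one, norm_mul,
    Complex.norm_exp_I_mul_ofReal, hn, one_mul]
  congr 3
  field_simp

theorem charFun_limitLaw {a b q : ℂ} (h0 : 0 < ‖a‖) (h1 : ‖a‖ < 1)
    (hqa : ‖a‖ * q = star a * b) {α β : ℂ} {w : ℝ}
    (hpos : ∀ x, 0 ≤ limitDensity a b α β w x) (ξ η : ℝ) :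
    2 * (Real.pi : ℂ) * charFun (limitLaw a b α β w) ξ =
      ∫ k in (-Real.pi)..Real.pi,
        limitIntegrand ‖a‖ q (rotation (-(w / 2)) *ᵥ ![α, β]) ξ (k + η) := by
  have hmeas : Measurable (limitDensity a b α β w) :=
    (measurable_konnoDensity a).mul (by fun_prop)
  rw [charFun_apply_real, limitLaw,
    integral_withDensity_eq_integral_toReal_smul hmeas.ennreal_ofReal (by simp)]
  simp_rw [ENNReal.toReal_ofReal (hpos _), limitDensity_eq (norm_pos_iff.1 h0) hqa]
  rw [integral_konnoDensity_mul h0 h1, integral_limitIntegrand h0 h1, ← mul_assoc,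
    mul_assoc 2, mul_inv_cancel₀ (by simp [Real.pi_ne_zero]), mul_one]
  congr 2
  ext m
  congr 2
  push_cast
  ring

theorem tendstoInDistribution_positionLaw {U : ℕ → Matrix (Fin 2) (Fin 2) ℂ} {φ : Fin 2 → ℂ}
    [∀ t, IsProbabilityMeasure (positionLaw U φ t)] {μ : Measure ℝ} [IsProbabilityMeasure μ]
    (h : ∀ ξ : ℝ, Tendsto (fun t : ℕ => ∑ x ∈ Finset.Icc (-(t : ℤ)) t,
      Complex.exp (Complex.I * (ξ / t * x : ℝ)) * prob U φ t x) atTop (𝓝 (charFun μ ξ))) :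
    TendstoInDistribution (fun (t : ℕ) (X : ℤ) => (X : ℝ) / (t : ℝ)) atTop (id : ℝ → ℝ)
      (fun t => positionLaw U φ t) μ where
  forall_aemeasurable t := (measurable_of_countable _).aemeasurable
  tendsto := by
    refine ProbabilityMeasure.tendsto_iff_tendsto_charFun.2 fun ξ => ?_
    simp only [ProbabilityMeasure.coe_mk, Measure.map_id]
    -- The two expressions agree at `t = 0` as well, since division by zero gives zero on both
    -- sides.
    refine (h ξ).congr fun t => ?_
    rw [charFun_apply_real, integral_map (measurable_of_countable _).aemeasurable
      (by fun_prop), ← integral_positionLaw U φ t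
        fun x => (Complex.norm_exp_I_mul_ofReal _).le]
    congr 1
    ext x
    congr 1
    push_cast
    ring

end QuantumWalk

theorem theorem3 (a b c d α β : ℂ) (κ₂ w₀ : ℝ)
    (hU : !![a, b; c, d] ∈ Matrix.unitaryGroup (Fin 2) ℂ)
    (habcd : a * b * c * d ≠ 0)
    (hαβ : ‖α‖ ^ 2 + ‖β‖ ^ 2 = 1) :
    (∀ t : ℕ, QuantumWalk.phaseCoin a b c d (κ₂ * t + w₀) =
      QuantumWalk.rotation ((κ₂ * t + w₀) / 2) * !![a, b; c, d] *
        QuantumWalk.rotation (-((κ₂ * t + w₀) / 2))) ∧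
    (∀ (t : ℕ) (x : ℤ),
      QuantumWalk.prob (fun s => QuantumWalk.phaseCoin a b c d (κ₂ * s + w₀)) ![α, β] t x =
        QuantumWalk.prob (fun _ => !![a, b; c, d])
          (QuantumWalk.rotation (-(w₀ / 2)) *ᵥ ![α, β]) t x) ∧
    (∀ x : ℝ, 0 ≤ QuantumWalk.limitDensity a b α β w₀ x) ∧
    ∃ (_ : ∀ t : ℕ, IsProbabilityMeasure (QuantumWalk.positionLaw
          (fun s => QuantumWalk.phaseCoin a b c d (κ₂ * s + w₀)) ![α, β] t))
      (_ : IsProbabilityMeasure (QuantumWalk.limitLaw a b α β w₀)),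
      TendstoInDistribution (fun (t : ℕ) (X : ℤ) => (X : ℝ) / (t : ℝ)) atTop (id : ℝ → ℝ)
        (fun t => QuantumWalk.positionLaw
          (fun s => QuantumWalk.phaseCoin a b c d (κ₂ * s + w₀)) ![α, β] t)
        (QuantumWalk.limitLaw a b α β w₀) := by
  open QuantumWalk in
  have ha : a ≠ 0 := by rintro rfl; simp at habcd
  have hb : b ≠ 0 := by rintro rfl; simp at habcd
  obtain ⟨s, η, q, hs, hq, hUs, hqb, hqa⟩ := exists_eq_polarCoin hU
  have h0 : 0 < ‖a‖ := norm_pos_iff.2 ha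
  have hq0 : 0 < ‖q‖ := hqb ▸ norm_pos_iff.2 hb
  -- Strict because `‖q‖ = ‖b‖ > 0`; this keeps `sin θ` away from zero.
  have h1 : ‖a‖ < 1 := by nlinarith
  set φ := rotation (-(w₀ / 2)) *ᵥ ![α, β] with hφ
  have hφn : ∑ j, ‖φ j‖ ^ 2 = 1 := by rw [hφ, sum_norm_sq_rotation_mulVec, hαβ]
  have hl := abs_drift_mul_le h0 hq hφn
  have hprob (t : ℕ) (x : ℤ) : prob (fun s => phaseCoin a b c d (κ₂ * s + w₀)) ![α, β] t x =
      prob (fun _ => !![a, b; c, d]) φ t x := prob_phaseCoin a b c d κ₂ w₀ _ t x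
  have hpos (x : ℝ) : 0 ≤ limitDensity a b α β w₀ x := by
    rw [limitDensity_eq ha hqa]
    exact konnoDensity_mul_nonneg h1 hl x
  have hlaw (t : ℕ) : IsProbabilityMeasure
      (positionLaw (fun s => phaseCoin a b c d (κ₂ * s + w₀)) ![α, β] t) := by
    refine isProbabilityMeasure_positionLaw ?_
    simp_rw [hprob, hUs]
    exact sum_prob_polarCoin h0.le h1 hq hs η hφn t
  have hlim : IsProbabilityMeasure (limitLaw a b α β w₀) := by
    refine ⟨?_⟩
    rw [limitLaw, withDensity_apply _ MeasurableSet.univ, Measure.restrict_univ]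
    simp_rw [limitDensity_eq ha hqa]
    exact lintegral_konnoDensity_mul h0 h1 hl
  refine ⟨fun t => phaseCoin_eq_rotation_mul a b c d _, hprob, hpos, hlaw, hlim,
    tendstoInDistribution_positionLaw fun ξ => ?_⟩
  simp_rw [hprob, hUs]
  have h := tendsto_sum_exp_mul_prob h0.le h1 hq hs η hφn ξ
  rw [← charFun_limitLaw h0 h1 hqa hpos ξ η] at h
  have hpi : (2 * Real.pi : ℂ) ≠ 0 := by simp [Real.pi_ne_zero]
  simpa only [inv_mul_cancel_left₀ hpi] using h.const_mul (2 * Real.pi : ℂ)⁻¹
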